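/- Let $H$ be a real or complex Hilbert space and let $A\colon D(A)\subseteq H\to H$ be the generator of a $C_0$-semigroup $(S(t))_{t\ge 0}$ on $H$. Then the following statements are equivalent. (i) The pair $(A,I)$ is locally passive, i.e. for all $T>0$ and all $u\in C([0,T],H)$ the mild solution $$x(t)=\int_0^t S(t-s)\,u(s)\,ds,\qquad t\in[0,T],$$ of the initial value problem $\dot x(t)=Ax(t)+u(t)$, $x(0)=0$, satisfies $$\operatorname{Re}\int_0^T\langle x(t),u(t)\rangle\,dt\ \ge\ 0 .$$ (ii) $A$ is dissipative, i.e. $\operatorname{Re}\langle Ax,x\rangle\le 0$ for all $x\in D(A)$. -/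

import Mathlib

open Filter Topology Set

/-- A `C₀`-semigroup of bounded linear operators on `H`: a family `S t`, `t ≥ 0`, with
`S 0 = I`, `S (s + t) = S s ∘ S t`, and `t ↦ S t x` continuous on `[0, ∞)` for every `x`.
The values of `S` at negative times are irrelevant and never used. -/
structure C0Semigroup (𝕜 H : Type*) [RCLike 𝕜] [NormedAddCommGroup H]
    [InnerProductSpace 𝕜 H] where
  /-- The operator at time `t`. -/
  op : ℝ → H →L[𝕜] H
  op_zero : op 0 = ContinuousLinearMap.id 𝕜 H
  op_add : ∀ s t : ℝ, 0 ≤ s → 0 ≤ t → op (s + t) = (op s).comp (op t)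
  continuousOn_orbit : ∀ x : H, ContinuousOn (fun t : ℝ => op t x) (Ici 0)

/-- The difference quotient `h⁻¹ (S(h) x - x)` of a semigroup at `0`. -/
noncomputable def C0Semigroup.diffQuot {𝕜 H : Type*} [RCLike 𝕜] [NormedAddCommGroup H]
    [InnerProductSpace 𝕜 H] [NormedSpace ℝ H] (S : C0Semigroup 𝕜 H) (x : H) (h : ℝ) : H :=
  h⁻¹ • (S.op h x - x)

theorem C0Semigroup.tendsto_diffQuot_add {𝕜 H : Type*} [RCLike 𝕜] [NormedAddCommGroup H]
    [InnerProductSpace 𝕜 H] [NormedSpace ℝ H] (S : C0Semigroup 𝕜 H) {x y v w : H}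
    (hx : Tendsto (S.diffQuot x) (𝓝[>] 0) (𝓝 v)) (hy : Tendsto (S.diffQuot y) (𝓝[>] 0) (𝓝 w)) :
    Tendsto (S.diffQuot (x + y)) (𝓝[>] 0) (𝓝 (v + w)) := by
  refine (hx.add hy).congr fun h => ?_
  simp only [C0Semigroup.diffQuot, map_add]
  rw [← smul_add]
  congr 1
  abel

theorem C0Semigroup.tendsto_diffQuot_smul {𝕜 H : Type*} [RCLike 𝕜] [NormedAddCommGroup H]
    [InnerProductSpace 𝕜 H] [NormedSpace ℝ H] [IsScalarTower ℝ 𝕜 H] (S : C0Semigroup 𝕜 H)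
    (c : 𝕜) {x v : H} (hx : Tendsto (S.diffQuot x) (𝓝[>] 0) (𝓝 v)) :
    Tendsto (S.diffQuot (c • x)) (𝓝[>] 0) (𝓝 (c • v)) := by
  refine (hx.const_smul c).congr fun h => ?_
  simp only [C0Semigroup.diffQuot, map_smul]
  rw [smul_comm, smul_sub]

/-- The infinitesimal generator of a `C₀`-semigroup: its domain is the set of all `x` for which
`lim_{h → 0+} h⁻¹ (S(h) x - x)` exists, and its value at `x` is this limit. -/
noncomputable def C0Semigroup.generator {𝕜 H : Type*} [RCLike 𝕜] [NormedAddCommGroup H]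
    [InnerProductSpace 𝕜 H] [NormedSpace ℝ H] [IsScalarTower ℝ 𝕜 H] (S : C0Semigroup 𝕜 H) :
    H →ₗ.[𝕜] H where
  domain :=
    { carrier := {x | ∃ y : H, Tendsto (S.diffQuot x) (𝓝[>] 0) (𝓝 y)}
      add_mem' := fun ⟨_, hv⟩ ⟨_, hw⟩ => ⟨_, S.tendsto_diffQuot_add hv hw⟩
      zero_mem' := ⟨0, tendsto_const_nhds.congr fun h => by simp [C0Semigroup.diffQuot]⟩
      smul_mem' := fun c _ ⟨_, hv⟩ => ⟨_, S.tendsto_diffQuot_smul c hv⟩ }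
  toFun :=
    { toFun := fun x => x.2.choose
      map_add' := fun x y => tendsto_nhds_unique (x + y).2.choose_spec
        (S.tendsto_diffQuot_add x.2.choose_spec y.2.choose_spec)
      map_smul' := fun c x => tendsto_nhds_unique (c • x).2.choose_spec
        (S.tendsto_diffQuot_smul c x.2.choose_spec) }

/-- The graph of the generator consists of the pairs `(x, y)` with
`h⁻¹ (S(h) x - x) → y` as `h → 0+`. -/
theorem C0Semigroup.mem_generator_graph {𝕜 H : Type*} [RCLike 𝕜] [NormedAddCommGroup H]
    [InnerProductSpace 𝕜 H] [NormedSpace ℝ H] [IsScalarTower ℝ 𝕜 H] (S : C0Semigroup 𝕜 H)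
    (x y : H) :
    (x, y) ∈ S.generator.graph ↔ Tendsto (S.diffQuot x) (𝓝[>] 0) (𝓝 y) := by
  rw [LinearPMap.mem_graph_iff]
  constructor
  · rintro ⟨z, rfl, rfl⟩
    exact z.2.choose_spec
  · intro h
    have hx : ∃ z : H, Tendsto (S.diffQuot x) (𝓝[>] 0) (𝓝 z) := ⟨y, h⟩
    exact ⟨⟨x, hx⟩, rfl, tendsto_nhds_unique hx.choose_spec h⟩

/-- `x` is, on `[0, T]`, the mild solution of `x'(t) = A x(t) + P u(t)`, `x(0) = x₀`:
`A` is the generator of a `C₀`-semigroup `S` and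
`x(t) = S(t) x₀ + ∫₀ᵗ S(t - s) P u(s) ds` for all `t ∈ [0, T]`. -/
def IsMildSolution {𝕜 H : Type*} [RCLike 𝕜] [NormedAddCommGroup H]
    [InnerProductSpace 𝕜 H] [NormedSpace ℝ H] [IsScalarTower ℝ 𝕜 H]
    (A : H →ₗ.[𝕜] H) (P : H →L[𝕜] H) (T : ℝ) (u : ℝ → H) (x₀ : H) (x : ℝ → H) : Prop :=
  ∃ S : C0Semigroup 𝕜 H, S.generator = A ∧
    ∀ t ∈ Icc (0 : ℝ) T, x t = S.op t x₀ + ∫ s in (0 : ℝ)..t, S.op (t - s) (P (u s))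

/-- The pair `(A, P)` is locally passive: for all `T > 0` and all `u ∈ C([0, T], H)`, the mild
solution `x` of `x' = A x + P u`, `x(0) = 0`, satisfies `Re ∫₀ᵀ ⟨x(t), P u(t)⟩ dt ≥ 0`. -/
def LocallyPassive {𝕜 H : Type*} [RCLike 𝕜] [NormedAddCommGroup H]
    [InnerProductSpace 𝕜 H] [NormedSpace ℝ H] [IsScalarTower ℝ 𝕜 H]
    (A : H →ₗ.[𝕜] H) (P : H →L[𝕜] H) : Prop :=
  ∀ T : ℝ, 0 < T → ∀ u : ℝ → H, ContinuousOn u (Icc 0 T) →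
    ∀ x : ℝ → H, IsMildSolution A P T u 0 x →
      0 ≤ RCLike.re (∫ t in (0 : ℝ)..T, inner 𝕜 (x t) (P (u t)))

/-- `A` is dissipative: `Re ⟨A x, x⟩ ≤ 0` for all `x` in the domain of `A`. -/
def Dissipative {𝕜 H : Type*} [RCLike 𝕜] [NormedAddCommGroup H]
    [InnerProductSpace 𝕜 H] (A : H →ₗ.[𝕜] H) : Prop :=
  ∀ x : A.domain, RCLike.re (inner 𝕜 (A x) (x : H)) ≤ 0

/-! If `A` is dissipative, `‖S(t)x‖²` has nonpositive right derivative for `x` in the domain; by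
density `S` is contractive (`norm_op_le_of_dissipative`). A mild solution need not be
differentiable, but splitting it at time `t` gives `x(z) = S(z - t) x(t) + (z - t) w` with `w →
u(t)`. Expanding the square and using contractivity bounds the right slopes of `‖x‖²` in the limit
by `2 Re ⟨x, u⟩`, whence `‖x(T)‖² ≤ 2 Re ∫ ⟨x, u⟩` (`norm_sq_duhamel_le`), so the right side is
nonnegative. Conversely, for `x` in the domain, the input `φ' x - φ A x` produces the solution `φ x`
(`integral_op_sub_eq`). If `φ` vanishes at both ends, `∫ φ φ' = 0` and passivity reads `-(∫ φ²) Re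
⟨x, A x⟩ ≥ 0`. -/

namespace C0Semigroup

variable {𝕜 H : Type*} [RCLike 𝕜] [NormedAddCommGroup H] [InnerProductSpace 𝕜 H]

/-- Orbits, extended to negative times by their initial value, are continuous. -/
theorem continuous_orbit_max (S : C0Semigroup 𝕜 H) (x : H) :
    Continuous fun t : ℝ => S.op (max t 0) x :=
  (S.continuousOn_orbit x).comp_continuous (continuous_id.max continuous_const)
    fun t => le_max_right t 0

theorem op_add_apply (S : C0Semigroup 𝕜 H) {s t : ℝ} (hs : 0 ≤ s) (ht : 0 ≤ t) (x : H) :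
    S.op (s + t) x = S.op s (S.op t x) := by
  rw [S.op_add s t hs ht]; rfl

theorem op_zero_apply (S : C0Semigroup 𝕜 H) (x : H) : S.op 0 x = x := by
  rw [S.op_zero]; rfl

theorem continuousOn_orbit_Icc (S : C0Semigroup 𝕜 H) (x : H) (T : ℝ) :
    ContinuousOn (fun t => S.op t x) (Icc 0 T) :=
  (S.continuousOn_orbit x).mono Icc_subset_Ici_self

/-- The operators are uniformly 1-Lipschitz, which upgrades strong continuity to joint continuity.
-/
theorem continuous_op_of_contractive (S : C0Semigroup 𝕜 H)
    (hS : ∀ t : ℝ, 0 ≤ t → ∀ x, ‖S.op t x‖ ≤ ‖x‖) :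
    Continuous fun p : ℝ × H => S.op (max p.1 0) p.2 := by
  refine continuous_prod_of_continuous_lipschitzWith' _ 1 (fun t => ?_) S.continuous_orbit_max
  refine LipschitzWith.of_dist_le_mul fun x y => ?_
  simpa [dist_eq_norm] using hS (max t 0) (le_max_right t 0) (x - y)

variable [NormedSpace ℝ H]

theorem op_intervalIntegral [CompleteSpace H] (S : C0Semigroup 𝕜 H) (t : ℝ) {a b : ℝ}
    {f : ℝ → H} (hf : Continuous f) :
    S.op t (∫ s in a..b, f s) = ∫ s in a..b, S.op t (f s) :=
  ((S.op t).intervalIntegral_comp_comm (hf.intervalIntegrable a b)).symm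

theorem tendsto_diffQuot_integral_orbit [CompleteSpace H] (S : C0Semigroup 𝕜 H) (x : H)
    {h : ℝ} (hh : 0 ≤ h) :
    Tendsto (S.diffQuot (∫ s in (0 : ℝ)..h, S.op (max s 0) x)) (𝓝[>] 0) (𝓝 (S.op h x - x)) := by
  set F : ℝ → H := fun s => S.op (max s 0) x with hF
  have hFc : Continuous F := S.continuous_orbit_max x
  -- For `r > 0` this difference is `∫ s in r..(h + r), F s = S(r) ∫ s in 0..h, F s`, up to the
  -- constant `∫ s in 0..h, F s`. Extending the orbit to negative times allows a two-sided
  -- derivative at `0`.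
  have hd : HasDerivAt (fun r => (∫ s in (0 : ℝ)..(h + r), F s) - ∫ s in (0 : ℝ)..r, F s)
      (F h - F 0) 0 := by
    refine HasDerivAt.sub ?_ (hFc.integral_hasStrictDerivAt 0 0).hasDerivAt
    have := (hFc.integral_hasStrictDerivAt 0 (h + 0)).hasDerivAt.comp_const_add h 0
    simpa using this
  have hd' := (hasDerivWithinAt_iff_tendsto_slope' (s := Ioi (0 : ℝ)) (by simp)).1
    hd.hasDerivWithinAt
  have e : F h - F 0 = S.op h x - x := by simp [hF, hh, S.op_zero_apply]
  rw [e] at hd'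
  refine hd'.congr' ?_
  filter_upwards [self_mem_nhdsWithin] with r hr
  have hr' : 0 ≤ r := le_of_lt hr
  have e1 : S.op r (∫ s in (0 : ℝ)..h, F s) = ∫ s in r..(h + r), F s := by
    rw [S.op_intervalIntegral r hFc]
    have := intervalIntegral.integral_comp_add_right (a := 0) (b := h) F r
    rw [zero_add] at this
    rw [← this]
    refine intervalIntegral.integral_congr fun s hs => ?_
    rw [uIcc_of_le hh] at hs
    simp only [hF]
    rw [max_eq_left hs.1, max_eq_left (add_nonneg hs.1 hr'), add_comm, S.op_add_apply hr' hs.1]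
  have e2 := intervalIntegral.integral_interval_sub_left (μ := MeasureTheory.volume)
    (hFc.intervalIntegrable 0 (h + r)) (hFc.intervalIntegrable 0 r)
  rw [slope_def_module, diffQuot, e1, e2]
  simp

/-! ### Duhamel integrals of a contraction semigroup. -/

/-- The Duhamel integral `∫ₐᵗ S(t - s) u(s) ds`. -/
noncomputable def duhamel (S : C0Semigroup 𝕜 H) (u : ℝ → H) (a t : ℝ) : H :=
  ∫ s in a..t, S.op (max (t - s) 0) (u s)

theorem continuous_duhamel (S : C0Semigroup 𝕜 H)
    (hS : ∀ t : ℝ, 0 ≤ t → ∀ x, ‖S.op t x‖ ≤ ‖x‖) {u : ℝ → H} (hu : Continuous u)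
    (a : ℝ) : Continuous (S.duhamel u a) := by
  refine intervalIntegral.continuous_parametric_intervalIntegral_of_continuous
    (f := fun t s => S.op (max (t - s) 0) (u s)) ?_ continuous_id
  exact (S.continuous_op_of_contractive hS).comp
    (f := fun p : ℝ × ℝ => (p.1 - p.2, u p.2)) (by fun_prop)

theorem duhamel_eq_add [CompleteSpace H] (S : C0Semigroup 𝕜 H)
    (hS : ∀ t : ℝ, 0 ≤ t → ∀ x, ‖S.op t x‖ ≤ ‖x‖) {u : ℝ → H} (hu : Continuous u)
    {t z : ℝ} (ht : 0 ≤ t) (hz : t ≤ z) :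
    S.duhamel u 0 z = S.op (z - t) (S.duhamel u 0 t) + S.duhamel u t z := by
  have hc : ∀ z : ℝ, Continuous fun s => S.op (max (z - s) 0) (u s) := fun z =>
    (S.continuous_op_of_contractive hS).comp (f := fun s : ℝ => (z - s, u s)) (by fun_prop)
  rw [duhamel, duhamel, duhamel, S.op_intervalIntegral _ (hc t),
    ← intervalIntegral.integral_add_adjacent_intervals
      ((hc z).intervalIntegrable 0 t) ((hc z).intervalIntegrable t z)]
  congr 1
  refine intervalIntegral.integral_congr fun s hs => ?_
  rw [uIcc_of_le ht] at hs
  have h1 : 0 ≤ t - s := sub_nonneg.2 hs.2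
  have h2 : 0 ≤ z - t := sub_nonneg.2 hz
  rw [max_eq_left h1, ← S.op_add_apply h2 h1, max_eq_left (by linarith)]
  congr 2
  ring

theorem tendsto_smul_duhamel [CompleteSpace H] (S : C0Semigroup 𝕜 H)
    (hS : ∀ t : ℝ, 0 ≤ t → ∀ x, ‖S.op t x‖ ≤ ‖x‖) {u : ℝ → H} (hu : Continuous u)
    (t : ℝ) :
    Tendsto (fun z => (z - t)⁻¹ • S.duhamel u t z) (𝓝[>] t) (𝓝 (u t)) := by
  -- Substituting `s = t + (z - t) r` turns the average over `[t, z]` into an integral over a fixed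
  -- interval, continuous in `z` up to `z = t`, where the integrand is `u t`.
  have hc : Continuous fun z : ℝ => ∫ r in (0 : ℝ)..1,
      S.op (max (z - (t + (z - t) * r)) 0) (u (t + (z - t) * r)) := by
    refine intervalIntegral.continuous_parametric_intervalIntegral_of_continuous'
      (f := fun z r => S.op (max (z - (t + (z - t) * r)) 0) (u (t + (z - t) * r))) ?_ 0 1
    exact (S.continuous_op_of_contractive hS).comp
      (f := fun p : ℝ × ℝ => (p.1 - (t + (p.1 - t) * p.2), u (t + (p.1 - t) * p.2)))
      (by fun_prop)
  have hl := (hc.tendsto t).mono_left (nhdsWithin_le_nhds (s := Ioi t))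
  simp only [sub_self, zero_mul, add_zero, max_self, S.op_zero_apply,
    intervalIntegral.integral_const, sub_zero, one_smul] at hl
  refine hl.congr' ?_
  filter_upwards [self_mem_nhdsWithin] with z hz
  have hz' : z - t ≠ 0 := sub_ne_zero.2 (ne_of_gt hz)
  have := intervalIntegral.smul_integral_comp_add_mul (a := 0) (b := 1)
    (fun s => S.op (max (z - s) 0) (u s)) (z - t) t
  rw [mul_zero, add_zero, mul_one, add_sub_cancel] at this
  rw [duhamel, ← this, inv_smul_smul₀ hz']

/-! ### Orbits in the domain, contractivity, and the energy inequality. -/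

variable [IsScalarTower ℝ 𝕜 H]

theorem op_diffQuot (S : C0Semigroup 𝕜 H) {t h : ℝ} (ht : 0 ≤ t) (hh : 0 ≤ h) (x : H) :
    S.op t (S.diffQuot x h) = h⁻¹ • (S.op (t + h) x - S.op t x) := by
  rw [diffQuot, ContinuousLinearMap.map_smul_of_tower, map_sub, S.op_add_apply ht hh]

theorem diffQuot_op (S : C0Semigroup 𝕜 H) {t h : ℝ} (ht : 0 ≤ t) (hh : 0 ≤ h) (x : H) :
    S.diffQuot (S.op t x) h = S.op t (S.diffQuot x h) := by
  rw [S.op_diffQuot ht hh, diffQuot, ← S.op_add_apply hh ht, add_comm]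

/-- The semigroup maps the domain of its generator to itself and commutes with it there. -/
theorem tendsto_diffQuot_op (S : C0Semigroup 𝕜 H) {t : ℝ} (ht : 0 ≤ t) {x y : H}
    (h : Tendsto (S.diffQuot x) (𝓝[>] 0) (𝓝 y)) :
    Tendsto (S.diffQuot (S.op t x)) (𝓝[>] 0) (𝓝 (S.op t y)) := by
  refine (((S.op t).continuous.tendsto y).comp h).congr' ?_
  filter_upwards [self_mem_nhdsWithin] with r hr
  exact (S.diffQuot_op ht (le_of_lt hr) x).symm

theorem hasDerivWithinAt_orbit (S : C0Semigroup 𝕜 H) {t : ℝ} (ht : 0 ≤ t) {x y : H}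
    (h : Tendsto (S.diffQuot x) (𝓝[>] 0) (𝓝 y)) :
    HasDerivWithinAt (fun t => S.op t x) (S.op t y) (Ici t) t := by
  rw [← hasDerivWithinAt_Ioi_iff_Ici, hasDerivWithinAt_iff_tendsto_slope' (by simp)]
  have hsub : Tendsto (fun z : ℝ => z - t) (𝓝[>] t) (𝓝[>] 0) := by
    refine tendsto_nhdsWithin_iff.2 ⟨?_, ?_⟩
    · have : Continuous fun z : ℝ => z - t := by fun_prop
      simpa using (this.tendsto t).mono_left nhdsWithin_le_nhds
    · filter_upwards [self_mem_nhdsWithin] with z hz using sub_pos.2 (mem_Ioi.1 hz)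
  refine (((S.op t).continuous.tendsto y).comp (h.comp hsub)).congr' ?_
  filter_upwards [self_mem_nhdsWithin] with z hz
  have hz' : t < z := hz
  simp only [Function.comp_apply]
  rw [S.op_diffQuot ht (sub_nonneg.2 hz'.le), slope_def_module, add_sub_cancel]

/-- The averages `h⁻¹ ∫ s in 0..h, S(s) x` lie in the domain and tend to `x`. -/
theorem dense_generator_domain [CompleteSpace H] (S : C0Semigroup 𝕜 H) :
    Dense {x : H | ∃ y, Tendsto (S.diffQuot x) (𝓝[>] 0) (𝓝 y)} := by
  intro x
  have hd := ((S.continuous_orbit_max x).integral_hasStrictDerivAt 0 0).hasDerivAt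
  have hd' := (hasDerivWithinAt_iff_tendsto_slope' (s := Ioi (0 : ℝ)) (by simp)).1
    hd.hasDerivWithinAt
  rw [max_self, S.op_zero_apply] at hd'
  refine mem_closure_of_tendsto hd' ?_
  filter_upwards [self_mem_nhdsWithin] with h hh
  simp only [slope_def_module, intervalIntegral.integral_same, sub_zero]
  have hm := S.tendsto_diffQuot_integral_orbit x (le_of_lt hh)
  refine ⟨((h⁻¹ : ℝ) : 𝕜) • (S.op h x - x), ?_⟩
  have := S.tendsto_diffQuot_smul ((h⁻¹ : ℝ) : 𝕜) hm
  rwa [RCLike.real_smul_eq_coe_smul (K := 𝕜) h⁻¹ (∫ s in (0 : ℝ)..h, S.op (max s 0) x)]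

/-- A semigroup with dissipative generator is contractive. -/
theorem norm_op_le_of_dissipative [CompleteSpace H] (S : C0Semigroup 𝕜 H)
    (hS : Dissipative S.generator) {t : ℝ} (ht : 0 ≤ t) (x : H) : ‖S.op t x‖ ≤ ‖x‖ := by
  refine S.dense_generator_domain.induction (P := fun x => ‖S.op t x‖ ≤ ‖x‖) ?_
    (isClosed_le (S.op t).continuous.norm continuous_norm) x
  rintro x ⟨y, hxy⟩
  have hdiss : ∀ {v w : H}, Tendsto (S.diffQuot v) (𝓝[>] 0) (𝓝 w) →
      RCLike.re (inner 𝕜 w v) ≤ 0 := by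
    intro v w h
    obtain ⟨z, rfl, rfl⟩ := (LinearPMap.mem_graph_iff _).1 ((S.mem_generator_graph v w).2 h)
    exact hS z
  have key : ∀ s ∈ Icc (0 : ℝ) t, RCLike.re (inner 𝕜 (S.op s x) (S.op s x)) ≤ ‖x‖ ^ 2 := by
    intro s hs
    have hc := S.continuousOn_orbit_Icc x t
    refine image_le_of_deriv_right_le_deriv_boundary
      (f := fun s => RCLike.re (inner 𝕜 (S.op s x) (S.op s x)))
      (f' := fun s => RCLike.re
        (inner 𝕜 (S.op s x) (S.op s y) + inner 𝕜 (S.op s y) (S.op s x)))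
      (B := fun _ => ‖x‖ ^ 2) (B' := fun _ => 0) (a := 0) (b := t)
      (RCLike.continuous_re.comp_continuousOn (hc.inner hc)) ?_ ?_ continuousOn_const
      (fun s _ => hasDerivWithinAt_const _ _ _) ?_ hs
    · intro s hs
      have hd := S.hasDerivWithinAt_orbit hs.1 hxy
      exact (RCLike.reCLM (K := 𝕜)).hasFDerivAt.comp_hasDerivWithinAt s (hd.inner 𝕜 hd)
    · rw [S.op_zero_apply, inner_self_eq_norm_sq]
    · intro s hs
      have := hdiss (S.tendsto_diffQuot_op hs.1 hxy)
      rw [map_add, inner_re_symm]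
      linarith
  have := key t ⟨ht, le_rfl⟩
  rw [inner_self_eq_norm_sq] at this
  exact le_of_sq_le_sq this (norm_nonneg x)

theorem norm_sq_duhamel_le [CompleteSpace H] (S : C0Semigroup 𝕜 H)
    (hS : ∀ t : ℝ, 0 ≤ t → ∀ x, ‖S.op t x‖ ≤ ‖x‖) {u : ℝ → H} (hu : Continuous u)
    {T : ℝ} (hT : 0 ≤ T) :
    ‖S.duhamel u 0 T‖ ^ 2 ≤ ∫ t in (0 : ℝ)..T, 2 * RCLike.re (inner 𝕜 (S.duhamel u 0 t) (u t)) := by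
  have hx := S.continuous_duhamel hS hu 0
  have hg : Continuous fun t => 2 * RCLike.re (inner 𝕜 (S.duhamel u 0 t) (u t)) :=
    continuous_const.mul (RCLike.continuous_re.comp (hx.inner hu))
  have hB := fun t => (hg.integral_hasStrictDerivAt 0 t).hasDerivAt
  refine image_le_of_liminf_slope_right_le_deriv_boundary
    (f := fun t => ‖S.duhamel u 0 t‖ ^ 2) (a := 0) (b := T)
    (hx.norm.pow 2).continuousOn (by simp [duhamel])
    (fun t _ => (hB t).continuousAt.continuousWithinAt)
    (fun t _ => (hB t).hasDerivWithinAt) ?_ ⟨hT, le_rfl⟩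
  intro t ht r hr
  refine Eventually.frequently ?_
  set x := S.duhamel u 0 t
  have hw := S.tendsto_smul_duhamel hS hu t
  have hop : Tendsto (fun z : ℝ => S.op (max (z - t) 0) x) (𝓝[>] t) (𝓝 x) := by
    have hc : Continuous fun z : ℝ => S.op (max (z - t) 0) x :=
      (S.continuous_orbit_max x).comp (continuous_id.sub continuous_const)
    simpa [S.op_zero_apply] using (hc.tendsto t).mono_left (nhdsWithin_le_nhds (s := Ioi t))
  have hzt : Tendsto (fun z : ℝ => z - t) (𝓝[>] t) (𝓝 0) := by
    have hc : Continuous fun z : ℝ => z - t := by fun_prop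
    simpa using (hc.tendsto t).mono_left (nhdsWithin_le_nhds (s := Ioi t))
  -- This expression, `2 Re ⟨S(z - t) x, w⟩ + (z - t) ‖w‖²`, dominates the slope of the squared norm
  -- because `‖S(z - t) x‖ ≤ ‖x‖`.
  have hlim := (((RCLike.continuous_re.tendsto _).comp (hop.inner (𝕜 := 𝕜) hw)).const_mul 2).add
    (hzt.mul (hw.norm.pow 2))
  rw [zero_mul, add_zero] at hlim
  filter_upwards [hlim.eventually (gt_mem_nhds hr), self_mem_nhdsWithin] with z hz hzt
  have hpos : 0 < z - t := sub_pos.2 hzt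
  refine lt_of_le_of_lt ?_ hz
  set w := (z - t)⁻¹ • S.duhamel u t z with hwdef
  have hd : S.duhamel u t z = ((z - t : ℝ) : 𝕜) • w := by
    rw [← RCLike.real_smul_eq_coe_smul, hwdef, smul_inv_smul₀ hpos.ne']
  rw [slope_def_field, div_le_iff₀ hpos, S.duhamel_eq_add hS hu ht.1 (le_of_lt hzt), hd,
    @norm_add_sq 𝕜, inner_smul_right, RCLike.re_ofReal_mul, norm_smul, RCLike.norm_ofReal,
    abs_of_pos hpos]
  have h1 : ‖S.op (z - t) x‖ ^ 2 ≤ ‖x‖ ^ 2 :=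
    pow_le_pow_left₀ (norm_nonneg _) (hS _ hpos.le x) 2
  simp only [Function.comp_apply, max_eq_left hpos.le]
  nlinarith

end C0Semigroup

/-! ### The two implications. -/

section Passivity

variable {𝕜 H : Type*} [RCLike 𝕜] [NormedAddCommGroup H] [InnerProductSpace 𝕜 H]
  [NormedSpace ℝ H] [IsScalarTower ℝ 𝕜 H] [CompleteSpace H]

theorem Dissipative.locallyPassive {A : H →ₗ.[𝕜] H} (hA : Dissipative A) :
    LocallyPassive A (ContinuousLinearMap.id 𝕜 H) := by
  -- The mild solution brings its own semigroup, so uniqueness of the semigroup generated by `A`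
  -- plays no role.
  rintro T hT u hu x ⟨S, rfl, hx⟩
  have hS : ∀ t : ℝ, 0 ≤ t → ∀ x, ‖S.op t x‖ ≤ ‖x‖ := fun t ht x =>
    S.norm_op_le_of_dissipative hA ht x
  obtain ⟨v, hv, hvu⟩ : ∃ v : ℝ → H, Continuous v ∧ ∀ t ∈ Icc 0 T, v t = u t :=
    ⟨IccExtend hT.le ((Icc 0 T).domRestrict u), hu.domRestrict.Icc_extend',
      fun t ht => by rw [IccExtend_of_mem _ _ ht, domRestrict_apply]⟩
  have hxd : ∀ t ∈ Icc 0 T, x t = S.duhamel v 0 t := by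
    intro t ht
    rw [hx t ht, map_zero, zero_add, C0Semigroup.duhamel]
    refine intervalIntegral.integral_congr fun s hs => ?_
    rw [uIcc_of_le ht.1] at hs
    simp only [ContinuousLinearMap.id_apply]
    rw [hvu s ⟨hs.1, hs.2.trans ht.2⟩, max_eq_left (sub_nonneg.2 hs.2)]
  have hint : ∫ t in (0 : ℝ)..T, inner 𝕜 (x t) (ContinuousLinearMap.id 𝕜 H (u t)) =
      ∫ t in (0 : ℝ)..T, inner 𝕜 (S.duhamel v 0 t) (v t) := by
    refine intervalIntegral.integral_congr fun t ht => ?_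
    rw [uIcc_of_le hT.le] at ht
    simp only [ContinuousLinearMap.id_apply]
    rw [hxd t ht, hvu t ht]
  have hle := S.norm_sq_duhamel_le hS hv hT.le
  have hc : Continuous fun t => inner 𝕜 (S.duhamel v 0 t) (v t) :=
    (S.continuous_duhamel hS hv 0).inner hv
  have hre : ∫ t in (0 : ℝ)..T, RCLike.re (inner 𝕜 (S.duhamel v 0 t) (v t)) =
      RCLike.re (∫ t in (0 : ℝ)..T, inner 𝕜 (S.duhamel v 0 t) (v t)) :=
    (RCLike.reCLM (K := 𝕜)).intervalIntegral_comp_comm (hc.intervalIntegrable 0 T)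
  rw [intervalIntegral.integral_const_mul, hre] at hle
  rw [hint]
  nlinarith [sq_nonneg ‖S.duhamel v 0 T‖]

/-- If `y = A x`, then `t ↦ φ(t) x` with `φ(0) = 0` is the mild solution for the input
`φ' x - φ y`. -/
theorem C0Semigroup.integral_op_sub_eq (S : C0Semigroup 𝕜 H) {x y : H}
    (hxy : Tendsto (S.diffQuot x) (𝓝[>] 0) (𝓝 y)) {φ φ' : ℝ → ℝ}
    (hφ : ∀ t, HasDerivAt φ (φ' t) t) (hφ' : Continuous φ') (hφ0 : φ 0 = 0) {t : ℝ}
    (ht : 0 ≤ t) :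
    ∫ s in (0 : ℝ)..t, S.op (t - s) (φ' s • x - φ s • y) = φ t • x := by
  have hφc : Continuous φ := continuous_iff_continuousAt.2 fun t => (hφ t).continuousAt
  have hx := S.continuousOn_orbit_Icc x t
  have hy := S.continuousOn_orbit_Icc y t
  have h1 : Continuous fun r => φ (t - r) := by fun_prop
  have h2 : Continuous fun r => φ' (t - r) := by fun_prop
  have hsub := intervalIntegral.integral_comp_sub_left (a := 0) (b := t)
    (fun r => S.op r (φ' (t - r) • x - φ (t - r) • y)) t
  simp only [sub_sub_cancel, sub_self, sub_zero] at hsub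
  rw [hsub]
  -- After reflection the integrand is minus the right derivative of `φ(t - r) S(r) x`, which runs
  -- from `φ(t) x` to `φ(0) S(t) x = 0`. Orbits are only known to be right differentiable here.
  have hftc := intervalIntegral.integral_eq_sub_of_hasDeriv_right (a := 0) (b := t)
    (f := fun r => φ (t - r) • S.op r x)
    (f' := fun r => φ (t - r) • S.op r y + (-φ' (t - r)) • S.op r x) ?_ ?_ ?_
  · have e : ∀ r, S.op r (φ' (t - r) • x - φ (t - r) • y) =
        -(φ (t - r) • S.op r y + (-φ' (t - r)) • S.op r x) := by
      intro r
      rw [map_sub, ContinuousLinearMap.map_smul_of_tower,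
        ContinuousLinearMap.map_smul_of_tower, neg_smul]
      abel
    simp only [e]
    rw [intervalIntegral.integral_neg, hftc]
    simp [hφ0, S.op_zero_apply]
  · rw [uIcc_of_le ht]
    exact h1.continuousOn.smul hx
  · intro r hr
    rw [min_eq_left ht] at hr
    have hd : HasDerivAt (fun r => φ (t - r)) (-φ' (t - r)) r := (hφ (t - r)).comp_const_sub t r
    exact hd.hasDerivWithinAt.smul
      (hasDerivWithinAt_Ioi_iff_Ici.2 (S.hasDerivWithinAt_orbit hr.1.le hxy))
  · refine ContinuousOn.intervalIntegrable ?_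
    rw [uIcc_of_le ht]
    exact (h1.continuousOn.smul hy).add (h2.neg.continuousOn.smul hx)

theorem C0Semigroup.dissipative_of_locallyPassive (S : C0Semigroup 𝕜 H)
    (hP : LocallyPassive S.generator (ContinuousLinearMap.id 𝕜 H)) :
    Dissipative S.generator := by
  intro z
  have hxy : Tendsto (S.diffQuot (z : H)) (𝓝[>] 0) (𝓝 (S.generator z)) :=
    (S.mem_generator_graph _ _).1 ((LinearPMap.mem_graph_iff _).2 ⟨z, rfl, rfl⟩)
  set x : H := (z : H)
  set y : H := S.generator z
  -- Zero at `0` for the initial condition, zero at `1` to kill `∫ φ φ'`, positive in between so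
  -- that `∫ φ² > 0`.
  set φ : ℝ → ℝ := fun t => t - t ^ 2 with hφdef
  set φ' : ℝ → ℝ := fun t => 1 - 2 * t with hφ'def
  have hφ : ∀ t, HasDerivAt φ (φ' t) t := fun t => by
    simpa [hφ'def] using (hasDerivAt_id' t).fun_sub (hasDerivAt_pow 2 t)
  have hφc : Continuous φ := by fun_prop
  have hφ'c : Continuous φ' := by fun_prop
  have h := hP 1 one_pos (fun t => φ' t • x - φ t • y) (by fun_prop) (fun t => φ t • x)
    ⟨S, rfl, fun t ht => by
      simpa using (S.integral_op_sub_eq hxy hφ hφ'c (by simp [hφdef]) ht.1).symm⟩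
  have e : ∀ t, inner 𝕜 (φ t • x) (ContinuousLinearMap.id 𝕜 H (φ' t • x - φ t • y)) =
      (φ t * φ' t) • inner 𝕜 x x - (φ t ^ 2) • inner 𝕜 x y := by
    intro t
    simp only [ContinuousLinearMap.id_apply, RCLike.real_smul_eq_coe_smul (K := 𝕜),
      inner_sub_right, inner_smul_left, inner_smul_right, RCLike.conj_ofReal, smul_eq_mul,
      RCLike.ofReal_mul, RCLike.ofReal_pow]
    ring
  simp only [e] at h
  have i1 : ∫ t in (0 : ℝ)..1, φ t * φ' t = 0 := by
    have : ∀ t : ℝ, φ t * φ' t = t - 3 * t ^ 2 + 2 * t ^ 3 := fun t => by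
      simp only [hφdef, hφ'def]; ring
    simp only [this]
    have hi {f : ℝ → ℝ} (hf : Continuous f) :=
      hf.intervalIntegrable (μ := MeasureTheory.volume) 0 1
    rw [intervalIntegral.integral_add (hi (by fun_prop)) (hi (by fun_prop)),
      intervalIntegral.integral_sub (hi (by fun_prop)) (hi (by fun_prop))]
    simp
    norm_num
  have i2 : 0 < ∫ t in (0 : ℝ)..1, φ t ^ 2 := by
    refine intervalIntegral.intervalIntegral_pos_of_pos_on
      ((hφc.pow 2).intervalIntegrable 0 1) (fun t ht => ?_) one_pos
    have : 0 < φ t := by simp only [hφdef]; nlinarith [ht.1, ht.2]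
    positivity
  have c1 : Continuous fun t => (φ t * φ' t) • inner 𝕜 x x := by fun_prop
  have c2 : Continuous fun t => φ t ^ 2 • inner 𝕜 x y := by fun_prop
  rw [intervalIntegral.integral_sub (c1.intervalIntegrable 0 1) (c2.intervalIntegrable 0 1),
    intervalIntegral.integral_smul_const, intervalIntegral.integral_smul_const, i1, zero_smul,
    zero_sub, map_neg, RCLike.smul_re, inner_re_symm] at h
  nlinarith

end Passivity

theorem mainTheorem3 {𝕜 H : Type*} [RCLike 𝕜] [NormedAddCommGroup H]
    [InnerProductSpace 𝕜 H] [NormedSpace ℝ H] [IsScalarTower ℝ 𝕜 H] [CompleteSpace H]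
    (A : H →ₗ.[𝕜] H) (hA : ∃ S : C0Semigroup 𝕜 H, S.generator = A) :
    LocallyPassive A (ContinuousLinearMap.id 𝕜 H) ↔ Dissipative A := by
  obtain ⟨S, rfl⟩ := hA
  exact ⟨S.dissipative_of_locallyPassive, Dissipative.locallyPassive⟩
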